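/- For $k\in\mathbb N$, positive integers $s_1,\dots,s_k$ and real numbers $x_1,\dots,x_k$, the multiple polylogarithm of depth $k$ is \[ \mathrm{Li}^\star_{s_1,\dots,s_k}(x_1,\dots,x_k)=\sum_{n_1\ge n_2\ge\cdots\ge n_k\ge 1}\ \prod_{i=1}^k\frac{x_i^{n_i}}{n_i^{s_i}} . \] Write $\{1\}_r$ for $1$ repeated $r$ times, $\sqcup$ for concatenation of strings, $|\boldsymbol s|$ for the sum of the components of a tuple $\boldsymbol s$, and $\|\boldsymbol s\|$ for its number of components. Let $d\ge 1$, let $m_1,\dots,m_d$ and $u_1,\dots,u_{d-1}$ be non-negative integers, and let \[ \boldsymbol s=\Bigl(\textstyle\bigsqcup_{i=1}^{d-1}\{m_i+2,\{1\}_{u_i}\},\,m_d+2\Bigr). \] Let $p\in[1/2,3/2]$ with $p\ne 1$. Then \[ \mathrm{Li}^\star_{\{1\}_{|\boldsymbol s|}}\Bigl(\textstyle\bigsqcup_{i=1}^{d-1}\bigl\{1-p,\{1\}_{m_i},\frac1{1-p},\{1\}_{u_i}\bigr\},\,1-p,\{1\}_{m_d+1}\Bigr) =-\mathrm{Li}^\star_{\boldsymbol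 s}\Bigl(\{1\}_{\|\boldsymbol s\|-1},\,1-\tfrac1p\Bigr). \] If moreover $a\in[-1,1/3]$ satisfies $|a|\le\min(1,\,2/p-1)$, then \[ \mathrm{Li}^\star_{\{1\}_{|\boldsymbol s|}}\Bigl(\textstyle\bigsqcup_{i=1}^{d-1}\bigl\{1-p,\{1\}_{m_i},\frac1{1-p},\{1\}_{u_i}\bigr\},\,1-p,\{1\}_{m_d},\,1+\tfrac{ap}{1-p}\Bigr) =\mathrm{Li}^\star_{\boldsymbol s}\bigl(\{1\}_{\|\boldsymbol s\|-1},\,a\bigr)-\mathrm{Li}^\star_{\boldsymbol s}\Bigl(\{1\}_{\|\boldsymbol s\|-1},\,1-\tfrac1p\Bigr). \] All multiple series occurring in these two identities converge absolutely. -/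

import Mathlib

noncomputable section

/-- The index set `{(n₁, …, n_k) : n₁ ≥ n₂ ≥ ⋯ ≥ n_k ≥ 1}` of the nested sums of depth `k`. -/
def starIndex (k : ℕ) : Set (Fin k → ℕ) :=
  {n | (∀ i j : Fin k, i ≤ j → n j ≤ n i) ∧ ∀ i : Fin k, 1 ≤ n i}

/-- The summand `∏ᵢ xᵢ ^ nᵢ / nᵢ ^ sᵢ` for tuples `s` and `x` of the same length.
The default values of `getD` are never used when the lengths agree. -/
def starTerm (s : List ℕ) (x : List ℝ) (n : Fin s.length → ℕ) : ℝ :=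
  ∏ i : Fin s.length, x.getD i 0 ^ n i / (n i : ℝ) ^ s.getD i 0

/-- The multiple series defining `Li⋆_s(x)` converges (unconditionally, that is, absolutely). -/
def StarPolylogConverges (s : List ℕ) (x : List ℝ) : Prop :=
  Summable fun n : starIndex s.length => starTerm s x n

/-- The multiple polylogarithm
`Li⋆_s(x) = ∑_{n₁ ≥ ⋯ ≥ n_k ≥ 1} ∏ᵢ xᵢ ^ nᵢ / nᵢ ^ sᵢ`, where `k` is the common length
of `s` and `x`. -/
def starPolylog (s : List ℕ) (x : List ℝ) : ℝ :=
  ∑' n : starIndex s.length, starTerm s x n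

/-- The exponent tuple `(m₁+2, {1}_{u₁}, …, m_{d-1}+2, {1}_{u_{d-1}}, m_d+2)`;
only `m₁, …, m_d` and `u₁, …, u_{d-1}` enter. -/
def expTuple (d : ℕ) (m u : ℕ → ℕ) : List ℕ :=
  (List.range' 1 (d - 1)).flatMap (fun i => (m i + 2) :: List.replicate (u i) 1) ++ [m d + 2]

/-- The concatenation over `i = 1, …, d-1` of the strings
`1-p, {1}_{mᵢ}, 1/(1-p), {1}_{uᵢ}`. -/
def argBlocks (d : ℕ) (m u : ℕ → ℕ) (p : ℝ) : List ℝ :=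
  (List.range' 1 (d - 1)).flatMap
    (fun i => [1 - p] ++ List.replicate (m i) 1 ++ [1 / (1 - p)] ++ List.replicate (u i) 1)

/-- The string `{1}_{k-1}, a` of length `k` (for `k ≥ 1`). -/
def onesThen (k : ℕ) (a : ℝ) : List ℝ :=
  List.replicate (k - 1) 1 ++ [a]

/-- There are as many arguments as the sum of the exponent tuple. -/
theorem length_args (d : ℕ) (m u : ℕ → ℕ) (p y : ℝ) :
    (argBlocks d m u p ++ [1 - p] ++ List.replicate (m d) 1 ++ [y]).length = (expTuple d m u).sum := by
  have h : ∀ l : List ℕ,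
      (l.flatMap (fun i => [1 - p] ++ List.replicate (m i) (1 : ℝ) ++ [1 / (1 - p)] ++
        List.replicate (u i) 1)).length =
      (l.flatMap (fun i => (m i + 2) :: List.replicate (u i) 1)).sum := by
    intro l
    induction l with
    | nil => simp
    | cons a l ih =>
      rw [List.flatMap_cons, List.flatMap_cons, List.length_append, List.sum_append, ih]
      simp
      omega
  have h' := h (List.range' 1 (d - 1))
  simp only [argBlocks, expTuple, List.length_append, List.sum_append, h']
  simp
  omega

theorem length_args' (d : ℕ) (m u : ℕ → ℕ) (p : ℝ) :
    (argBlocks d m u p ++ [1 - p] ++ List.replicate (m d + 1) 1).length =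
      (expTuple d m u).sum := by
  rw [← length_args d m u p 1]
  simp

theorem length_onesThen (d : ℕ) (m u : ℕ → ℕ) (a : ℝ) :
    (onesThen (expTuple d m u).length a).length = (expTuple d m u).length := by
  simp [onesThen, expTuple]

end

/-! Truncating at `n₁ ≤ N` turns each multiple series into a composition of operators `weightedSum`.
The engine is the Euler transform `binomOp α β`. For sequences vanishing at 0, plain summation with
weight `1/n` commutes with it when `α + β = 1` (`weightedSum_binomOp_of_add`), and becomes division
by `i` under it when `β = 1` (`weightedSum_binomOp_of_one`). A factor `cⁿ` rescales `(α, β)` to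
`(cα, cβ)`, so the arguments `1/(1-p)` and `1-p` switch between the regimes `(p, 1-p)` and
`(p/(1-p), 1)`. Each block of arguments thus collapses to an exponent `mᵢ+2` followed by ones.

The innermost sequence must vanish at 0, so last arguments `1 + ap/(1-p)` and `1` are subtracted.
This gives an exact identity of partial sums, `nestedSum_argPairs_sub`. In the limit the transform
disappears by regularity of Euler summation (`limit_binomOp_eq`). The value `a = 1 - 1/p` makes the
last argument 0, which kills one series and yields the first identity; the second follows by
substitution.

Absolute convergence comes from two growth classes, `√n` and `rⁿ/√n` with `r = 1/|1-p| ≥ 2`. -/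

open Filter Topology Finset

/-! ### Summation operators and truncated multiple series -/

/-- The weighted partial sums `N ↦ ∑_{1 ≤ n ≤ N} xⁿ / nᵉ · f n`. -/
noncomputable def weightedSum (e : ℕ) (x : ℝ) (f : ℕ → ℝ) (N : ℕ) : ℝ :=
  ∑ n ∈ Icc 1 N, x ^ n / (n : ℝ) ^ e * f n

/-- Iterated weighted partial sums, the head of the list being the outermost one. -/
noncomputable def nestedSum (L : List (ℕ × ℝ)) (g : ℕ → ℝ) : ℕ → ℝ :=
  L.foldr (fun c f => weightedSum c.1 c.2 f) g

theorem weightedSum_zero_right (e : ℕ) (x : ℝ) (f : ℕ → ℝ) : weightedSum e x f 0 = 0 := by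
  simp [weightedSum]

theorem weightedSum_succ (e : ℕ) (x : ℝ) (f : ℕ → ℝ) (N : ℕ) :
    weightedSum e x f (N + 1) =
      weightedSum e x f N + x ^ (N + 1) / ((N + 1 : ℕ) : ℝ) ^ e * f (N + 1) := by
  simp only [weightedSum]
  rw [sum_Icc_succ_top (by omega)]

theorem weightedSum_sub (e : ℕ) (x : ℝ) (f g : ℕ → ℝ) :
    weightedSum e x (f - g) = weightedSum e x f - weightedSum e x g := by
  ext N
  simp [weightedSum, mul_sub]

/-- Powers of the argument can be moved between the weight and the sequence; only indices `n ≥ 1`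
matter. -/
theorem weightedSum_congr (e : ℕ) (x y : ℝ) {f g : ℕ → ℝ}
    (h : ∀ n, 1 ≤ n → x ^ n * f n = y ^ n * g n) : weightedSum e x f = weightedSum e y g := by
  ext N
  refine sum_congr rfl fun n hn => ?_
  rw [div_mul_eq_mul_div, div_mul_eq_mul_div, h n (mem_Icc.1 hn).1]

@[simp] theorem nestedSum_nil (g : ℕ → ℝ) : nestedSum [] g = g := rfl

@[simp] theorem nestedSum_cons (c : ℕ × ℝ) (L : List (ℕ × ℝ)) (g : ℕ → ℝ) :
    nestedSum (c :: L) g = weightedSum c.1 c.2 (nestedSum L g) := rfl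

theorem nestedSum_append (L L' : List (ℕ × ℝ)) (g : ℕ → ℝ) :
    nestedSum (L ++ L') g = nestedSum L (nestedSum L' g) := by
  simp [nestedSum, List.foldr_append]

theorem nestedSum_sub (L : List (ℕ × ℝ)) (f g : ℕ → ℝ) :
    nestedSum L (f - g) = nestedSum L f - nestedSum L g := by
  induction L with
  | nil => rfl
  | cons c L ih => simp [ih, weightedSum_sub]

theorem nestedSum_zero (L : List (ℕ × ℝ)) : nestedSum L 0 = 0 := by
  simpa using nestedSum_sub L 0 0

/-- The finite set `{(n₁, …, n_k) : N ≥ n₁ ≥ ⋯ ≥ n_k ≥ 1}`. -/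
def starFinset : (k : ℕ) → ℕ → Finset (Fin k → ℕ)
  | 0, _ => {Fin.elim0}
  | k + 1, N => (Icc 1 N).biUnion fun n => (starFinset k n).image (Fin.cons n)

theorem mem_starFinset {k N : ℕ} {n : Fin k → ℕ} :
    n ∈ starFinset k N ↔ n ∈ starIndex k ∧ ∀ i, n i ≤ N := by
  induction k generalizing N with
  | zero => simp [starFinset, starIndex, Subsingleton.elim n Fin.elim0]
  | succ k ih =>
    simp only [starFinset, mem_biUnion, mem_Icc, mem_image, ih]
    constructor
    · rintro ⟨a, ⟨ha, haN⟩, n', ⟨⟨h1, h2⟩, h3⟩, rfl⟩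
      refine ⟨⟨fun i j hij => ?_, fun i => ?_⟩, fun i => ?_⟩
      · induction i using Fin.cases with
        | zero =>
          induction j using Fin.cases with
          | zero => rfl
          | succ j => simpa using h3 j
        | succ i =>
          induction j using Fin.cases with
          | zero => exact absurd hij (by simp)
          | succ j => simpa using h1 i j (by simpa using hij)
      · induction i using Fin.cases with
        | zero => simpa using ha
        | succ i => simpa using h2 i
      · induction i using Fin.cases with
        | zero => simpa using haN
        | succ i => simpa using (h3 i).trans haN
    · rintro ⟨⟨h1, h2⟩, h3⟩
      refine ⟨n 0, ⟨h2 0, h3 0⟩, Fin.tail n, ⟨⟨fun i j hij => ?_, fun i => h2 _⟩, fun i => ?_⟩,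
        Fin.cons_self_tail n⟩
      · exact h1 _ _ (by simpa using hij)
      · exact h1 _ _ (Fin.zero_le _)

theorem sum_starFinset_starTerm (L : List (ℕ × ℝ)) (N : ℕ) :
    ∑ n ∈ starFinset (L.map Prod.fst).length N, starTerm (L.map Prod.fst) (L.map Prod.snd) n =
      nestedSum L 1 N := by
  induction L generalizing N with
  | nil =>
    change ∑ n ∈ starFinset 0 N, _ = _
    rw [starFinset, sum_singleton]
    exact Fin.prod_univ_zero _
  | cons c L ih =>
    change ∑ n ∈ starFinset ((L.map Prod.fst).length + 1) N,
      starTerm (c.1 :: L.map Prod.fst) (c.2 :: L.map Prod.snd) n = _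
    rw [starFinset, sum_biUnion]
    · rw [nestedSum_cons, weightedSum]
      refine sum_congr rfl fun a _ => ?_
      rw [sum_image (fun x _ y _ h => (Fin.cons_injective2 h).2), ← ih, mul_sum]
      refine sum_congr rfl fun n _ => ?_
      exact Fin.prod_univ_succ (n := (L.map Prod.fst).length) _
    · intro a _ b _ hab
      refine disjoint_left.2 fun n hn hn' => hab ?_
      obtain ⟨x, -, rfl⟩ := mem_image.1 hn
      obtain ⟨y, -, h⟩ := mem_image.1 hn'
      exact (Fin.cons_injective2 h).1.symm

theorem abs_starTerm (L : List (ℕ × ℝ)) (n : Fin (L.map Prod.fst).length → ℕ) :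
    |starTerm (L.map Prod.fst) (L.map Prod.snd) n| =
      starTerm (L.map Prod.fst) ((L.map Prod.snd).map abs) n := by
  rw [starTerm, starTerm, abs_prod]
  refine prod_congr rfl fun i _ => ?_
  have h := List.getD_map (l := L.map Prod.snd) (d := 0) (n := i) (f := (abs : ℝ → ℝ))
  rw [abs_zero] at h
  rw [h, abs_div, abs_pow, abs_of_nonneg (by positivity : (0 : ℝ) ≤ (n i : ℝ) ^ _)]

/-- If the nested sums of absolute values are bounded, then the series of the multiple
polylogarithm converges absolutely and is the limit of its partial sums over `n₁ ≤ N`. -/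
theorem starPolylog_tendsto (L : List (ℕ × ℝ)) {C : ℝ}
    (hC : ∀ N, nestedSum (L.map fun c => (c.1, |c.2|)) 1 N ≤ C) :
    StarPolylogConverges (L.map Prod.fst) (L.map Prod.snd) ∧
      Tendsto (nestedSum L 1) atTop
        (𝓝 (starPolylog (L.map Prod.fst) (L.map Prod.snd))) := by
  classical
  set k := (L.map Prod.fst).length
  have habs : ∀ N, ∑ n ∈ starFinset k N, |starTerm (L.map Prod.fst) (L.map Prod.snd) n| ≤ C := by
    intro N
    refine le_trans (le_of_eq ?_) (hC N)
    have h := sum_starFinset_starTerm (L.map fun c => (c.1, |c.2|)) N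
    have h1 : (L.map fun c => (c.1, |c.2|)).map Prod.fst = L.map Prod.fst := by simp
    have h2 : (L.map fun c => (c.1, |c.2|)).map Prod.snd = (L.map Prod.snd).map abs := by simp
    rw [h1, h2] at h
    rw [← h]
    exact sum_congr rfl fun n _ => abs_starTerm L n
  -- The truncations exhaust the index set: a tuple lies in every truncation from the sum of its
  -- entries onward.
  let A : ℕ → Finset (starIndex k) := fun N => (starFinset k N).subtype (· ∈ starIndex k)
  have hA : Tendsto A atTop atTop := by
    refine tendsto_atTop_finset_of_monotone (fun M N hMN n hn => ?_) (fun n => ?_)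
    · simp only [A, mem_subtype, mem_starFinset] at hn ⊢
      exact ⟨hn.1, fun i => (hn.2 i).trans hMN⟩
    · refine ⟨∑ i, n.1 i, ?_⟩
      simp only [A, mem_subtype, mem_starFinset]
      exact ⟨n.2, fun i => single_le_sum (f := n.1) (fun _ _ => Nat.zero_le _) (mem_univ i)⟩
  have hsum : ∀ (f : (Fin k → ℕ) → ℝ) N, ∑ n ∈ A N, f n = ∑ n ∈ starFinset k N, f n := by
    intro f N
    exact sum_subtype_of_mem f fun n hn => (mem_starFinset.1 hn).1
  have hS : Summable fun n : starIndex k =>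
      starTerm (L.map Prod.fst) (L.map Prod.snd) n := by
    refine Summable.of_abs (summable_of_sum_le (c := C) (fun _ => abs_nonneg _) fun t => ?_)
    obtain ⟨N, hN⟩ := (hA.eventually (eventually_ge_atTop t)).exists
    refine le_trans (sum_le_sum_of_subset_of_nonneg hN fun _ _ _ => abs_nonneg _) ?_
    rw [hsum (fun n => |starTerm (L.map Prod.fst) (L.map Prod.snd) n|)]
    exact habs N
  refine ⟨hS, ?_⟩
  have h := hS.hasSum.comp hA
  refine h.congr fun N => ?_
  rw [Function.comp_apply, hsum (fun n => starTerm (L.map Prod.fst) (L.map Prod.snd) n)]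
  exact sum_starFinset_starTerm L N

/-! ### The Euler transform -/

/-- The binomial operator `g ↦ (n ↦ ∑ᵢ C(n, i) αⁱ βⁿ⁻ⁱ g i)`, given by its Pascal recursion. -/
noncomputable def binomOp (α β : ℝ) : (ℕ → ℝ) → ℕ → ℝ
  | g, 0 => g 0
  | g, n + 1 => α * binomOp α β (fun i => g (i + 1)) n + β * binomOp α β g n

theorem binomOp_zero (α β : ℝ) (g : ℕ → ℝ) : binomOp α β g 0 = g 0 := by
  rw [binomOp]

theorem binomOp_succ (α β : ℝ) (g : ℕ → ℝ) (n : ℕ) :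
    binomOp α β g (n + 1) = α * binomOp α β (fun i => g (i + 1)) n + β * binomOp α β g n := by
  rw [binomOp]

theorem binomOp_add (α β : ℝ) (f g : ℕ → ℝ) (n : ℕ) :
    binomOp α β (fun i => f i + g i) n = binomOp α β f n + binomOp α β g n := by
  induction n generalizing f g with
  | zero => simp only [binomOp_zero]
  | succ n ih =>
    rw [binomOp_succ, binomOp_succ, binomOp_succ, ih f g, ih (fun i => f (i + 1))]
    ring

theorem binomOp_const_mul (α β c : ℝ) (g : ℕ → ℝ) (n : ℕ) :
    binomOp α β (fun i => c * g i) n = c * binomOp α β g n := by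
  induction n generalizing g with
  | zero => simp only [binomOp_zero]
  | succ n ih =>
    rw [binomOp_succ, binomOp_succ, ih g, ih (fun i => g (i + 1))]
    ring

theorem binomOp_pow (α β a : ℝ) (n : ℕ) :
    binomOp α β (fun i => a ^ i) n = (α * a + β) ^ n := by
  induction n with
  | zero => simp [binomOp_zero]
  | succ n ih =>
    have h : (fun i => a ^ (i + 1)) = fun i => a * a ^ i := by ext i; ring
    rw [binomOp_succ, h, binomOp_const_mul, ih]
    ring

theorem binomOp_mono {α β : ℝ} (hα : 0 ≤ α) (hβ : 0 ≤ β) {f g : ℕ → ℝ} (h : ∀ i, f i ≤ g i)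
    (n : ℕ) : binomOp α β f n ≤ binomOp α β g n := by
  induction n generalizing f g with
  | zero => simpa only [binomOp_zero] using h 0
  | succ n ih =>
    rw [binomOp_succ, binomOp_succ]
    have h1 := ih h
    have h2 := ih fun i => h (i + 1)
    gcongr

/-- Write `cⁿ = cⁱ cⁿ⁻ⁱ` inside the binomial sum. -/
theorem pow_mul_binomOp (α β c : ℝ) (g : ℕ → ℝ) (n : ℕ) :
    c ^ n * binomOp α β g n = binomOp (c * α) (c * β) g n := by
  induction n generalizing g with
  | zero => simp [binomOp_zero]
  | succ n ih =>
    rw [binomOp_succ, binomOp_succ, ← ih g, ← ih]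
    ring

/-- Absorption: `∑ᵢ i C(n+1, i) αⁱ βⁿ⁺¹⁻ⁱ h (i-1) = (n+1) α ∑ᵢ C(n, i) αⁱ βⁿ⁻ⁱ h i`. -/
theorem binomOp_absorb (α β : ℝ) (h : ℕ → ℝ) (n : ℕ) :
    binomOp α β (fun i => i * h (i - 1)) (n + 1) = (n + 1) * α * binomOp α β h n := by
  induction n generalizing h with
  | zero => simp [binomOp_succ, binomOp_zero]
  | succ n ih =>
    have h1 : (fun i : ℕ => ((i + 1 : ℕ) : ℝ) * h (i + 1 - 1)) =
        fun i : ℕ => (i : ℝ) * h (i - 1 + 1) + h i := by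
      ext i
      cases i with
      | zero => simp
      | succ i => simp only [Nat.add_sub_cancel]; push_cast; ring
    rw [binomOp_succ, h1, binomOp_add, ih fun j => h (j + 1), ih, binomOp_succ α β h n]
    push_cast
    ring

/-- Absorption with `h i = g (i+1) / (i+1)`; the factor `i` erases the value at 0, hence the
condition on `g 0`. -/
theorem binomOp_succ_of_zero {α β : ℝ} {g : ℕ → ℝ} (hg : g 0 = 0) (n : ℕ) :
    binomOp α β g (n + 1) =
      (n + 1) * α * binomOp α β (fun i => g (i + 1) / ((i + 1 : ℕ) : ℝ)) n := by
  rw [← binomOp_absorb]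
  congr 1
  ext i
  cases i with
  | zero => simp [hg]
  | succ i => simp only [Nat.add_sub_cancel]; field_simp

/-- Compare increments in `N`: with `β = 1` Pascal's rule leaves `α` times the transform of the
shifted `g i / i`, which absorption identifies with the new summand. -/
theorem weightedSum_binomOp_of_one (α : ℝ) {g : ℕ → ℝ} (hg : g 0 = 0) :
    weightedSum 1 1 (binomOp α 1 g) = binomOp α 1 fun i => g i / i := by
  ext N
  induction N with
  | zero => simp [weightedSum_zero_right, binomOp_zero]
  | succ N ih =>
    rw [weightedSum_succ, ih, binomOp_succ_of_zero hg,
      binomOp_succ α 1 (fun i => g i / i)]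
    push_cast
    field_simp
    ring

/-- Again by increments: shifting the partial sums adds `g (i+1) / (i+1)`, and `α + β = 1`
recombines the unshifted parts. -/
theorem weightedSum_binomOp_of_add {α β : ℝ} (h : α + β = 1) {g : ℕ → ℝ} (hg : g 0 = 0) :
    weightedSum 1 1 (binomOp α β g) = binomOp α β (weightedSum 1 1 g) := by
  obtain rfl : β = 1 - α := by linarith
  ext N
  induction N with
  | zero => simp [weightedSum_zero_right, binomOp_zero]
  | succ N ih =>
    have h1 : (fun i => weightedSum 1 1 g (i + 1)) =
        fun i => weightedSum 1 1 g i + g (i + 1) / ((i + 1 : ℕ) : ℝ) := by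
      ext i
      rw [weightedSum_succ]
      simp [div_eq_inv_mul]
    rw [weightedSum_succ, ih, binomOp_succ_of_zero hg,
      binomOp_succ α (1 - α) (weightedSum 1 1 g), h1, binomOp_add]
    push_cast
    field_simp
    ring

/-- On powers `aⁿ` the transform acts through the affine map `a ↦ 1 + p(a - 1)`; these maps compose
by multiplying slopes. -/
theorem binomOp_binomOp_of_mul_eq_one {p q : ℝ} (h : q * p = 1) (g : ℕ → ℝ) (n : ℕ) :
    binomOp q (1 - q) (binomOp p (1 - p) g) n = g n := by
  induction n generalizing g with
  | zero => simp [binomOp_zero]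
  | succ n ih =>
    have h1 : (fun i => binomOp p (1 - p) g (i + 1)) = fun i =>
        p * binomOp p (1 - p) (fun i => g (i + 1)) i + (1 - p) * binomOp p (1 - p) g i := by
      ext i
      rw [binomOp_succ]
    rw [binomOp_succ, h1, binomOp_add, binomOp_const_mul, binomOp_const_mul, ih, ih]
    linear_combination (g (n + 1) - g n) * h

/-- Euler summation is regular. -/
theorem tendsto_binomOp {p : ℝ} (hp0 : 0 < p) (hp1 : p ≤ 1) {g : ℕ → ℝ} {l : ℝ}
    (hg : Tendsto g atTop (𝓝 l)) : Tendsto (binomOp p (1 - p) g) atTop (𝓝 l) := by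
  have hone : ∀ (c : ℝ) n, binomOp p (1 - p) (fun _ => c) n = c := by
    intro c n
    have := binomOp_const_mul p (1 - p) c (fun i => 1 ^ i) n
    rw [binomOp_pow] at this
    simpa using this
  rw [Metric.tendsto_atTop] at hg ⊢
  intro ε hε
  obtain ⟨K, hK⟩ := hg (ε / 2) (by positivity)
  set M : ℝ := ∑ i ∈ range K, |g i - l| with hM
  have hM0 : 0 ≤ M := sum_nonneg fun _ _ => abs_nonneg _
  -- The finitely many large errors are absorbed into a geometric sequence, whose transform is
  -- explicit by the binomial theorem and has ratio `1 - p/2 < 1`.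
  have hb : ∀ i, |g i - l| ≤ ε / 2 + M * 2 ^ K * (1 / 2) ^ i := by
    intro i
    rcases lt_or_ge i K with hi | hi
    · have h1 : |g i - l| ≤ M :=
        single_le_sum (f := fun i => |g i - l|) (fun _ _ => abs_nonneg _) (mem_range.2 hi)
      have h2 : (1 : ℝ) ≤ 2 ^ K * (1 / 2) ^ i := by
        rw [one_div, inv_pow, ← div_eq_mul_inv, one_le_div (by positivity)]
        exact pow_le_pow_right₀ one_le_two hi.le
      nlinarith [mul_le_mul_of_nonneg_left h2 hM0]
    · have h1 := (hK i hi).le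
      rw [Real.dist_eq] at h1
      have : 0 ≤ M * 2 ^ K * (1 / 2) ^ i := by positivity
      linarith
  have hB : ∀ n, |binomOp p (1 - p) g n - l| ≤
      ε / 2 + M * 2 ^ K * (p * (1 / 2) + (1 - p)) ^ n := by
    intro n
    have hlow := binomOp_mono hp0.le (sub_nonneg.2 hp1)
      (f := fun i => (-1) * (ε / 2 + M * 2 ^ K * (1 / 2) ^ i) + l) (g := g)
      (fun i => by have := (abs_le.1 (hb i)).1; linarith) n
    have hupp := binomOp_mono hp0.le (sub_nonneg.2 hp1)
      (f := g) (g := fun i => (ε / 2 + M * 2 ^ K * (1 / 2) ^ i) + l)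
      (fun i => by have := (abs_le.1 (hb i)).2; linarith) n
    rw [binomOp_add, binomOp_const_mul, binomOp_add, binomOp_const_mul, binomOp_pow, hone,
      hone] at hlow
    rw [binomOp_add, binomOp_add, binomOp_const_mul, binomOp_pow, hone, hone] at hupp
    exact abs_le.2 ⟨by linarith, by linarith⟩
  have ht : Tendsto (fun n : ℕ => M * 2 ^ K * (p * (1 / 2) + (1 - p)) ^ n) atTop (𝓝 0) := by
    have := (tendsto_pow_atTop_nhds_zero_of_lt_one (r := p * (1 / 2) + (1 - p))
      (by linarith) (by linarith)).const_mul (M * 2 ^ K)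
    simpa using this
  obtain ⟨N, hN⟩ := (ht.eventually (gt_mem_nhds (half_pos hε))).exists_forall_of_atTop
  refine ⟨N, fun n hn => ?_⟩
  rw [Real.dist_eq]
  have := hB n
  have := hN n hn
  linarith

/-! ### Moving the transform through the strings of arguments -/

theorem weightedSum_binomOp_of_mul {p : ℝ} (hp : p ≠ 1) {y : ℝ} (hy : y = 1 - p) {g : ℕ → ℝ}
    (hg : g 0 = 0) :
    weightedSum 1 y (binomOp (p / (1 - p)) 1 g) = binomOp p (1 - p) (weightedSum 1 1 g) := by
  have hp' : 1 - p ≠ 0 := sub_ne_zero.2 hp.symm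
  rw [← weightedSum_binomOp_of_add (by ring) hg]
  refine weightedSum_congr _ _ _ fun n _ => ?_
  rw [hy, pow_mul_binomOp, mul_div_cancel₀ _ hp', mul_one, one_pow, one_mul]

theorem weightedSum_binomOp_of_inv {p : ℝ} (hp : p ≠ 1) {g : ℕ → ℝ} (hg : g 0 = 0) :
    weightedSum 1 (1 / (1 - p)) (binomOp p (1 - p) g) =
      binomOp (p / (1 - p)) 1 fun i => g i / i := by
  have hp' : 1 - p ≠ 0 := sub_ne_zero.2 hp.symm
  rw [← weightedSum_binomOp_of_one _ hg]
  refine weightedSum_congr _ _ _ fun n _ => ?_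
  rw [pow_mul_binomOp, one_div_mul_cancel hp', one_pow, one_mul, one_div_mul_eq_div]

theorem nestedSum_replicate_binomOp_of_one (α : ℝ) (k : ℕ) {g : ℕ → ℝ} (hg : g 0 = 0) :
    nestedSum (List.replicate k (1, 1)) (binomOp α 1 g) =
      binomOp α 1 fun i => g i / (i : ℝ) ^ k := by
  induction k with
  | zero => simp
  | succ k ih =>
    rw [List.replicate_succ, nestedSum_cons, ih, weightedSum_binomOp_of_one _ (by simp [hg])]
    simp only [div_div, pow_succ]

theorem nestedSum_replicate_zero_right (k : ℕ) {g : ℕ → ℝ} (hg : g 0 = 0) :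
    nestedSum (List.replicate k (1, 1)) g 0 = 0 := by
  cases k with
  | zero => simpa
  | succ k => rw [List.replicate_succ, nestedSum_cons, weightedSum_zero_right]

theorem nestedSum_replicate_binomOp_of_add {α β : ℝ} (h : α + β = 1) (k : ℕ) {g : ℕ → ℝ}
    (hg : g 0 = 0) :
    nestedSum (List.replicate k (1, 1)) (binomOp α β g) =
      binomOp α β (nestedSum (List.replicate k (1, 1)) g) := by
  induction k with
  | zero => simp
  | succ k ih =>
    rw [List.replicate_succ, nestedSum_cons, ih, nestedSum_cons,
      weightedSum_binomOp_of_add h (nestedSum_replicate_zero_right k hg)]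

theorem weightedSum_div_pow (e k : ℕ) (x : ℝ) (g : ℕ → ℝ) :
    weightedSum e x (fun i => g i / (i : ℝ) ^ k) = weightedSum (e + k) x g := by
  ext N
  refine sum_congr rfl fun n _ => ?_
  rw [pow_add]
  field_simp

theorem weightedSum_div (e : ℕ) (x : ℝ) (g : ℕ → ℝ) :
    weightedSum e x (fun i => g i / i) = weightedSum (e + 1) x g := by
  simpa using weightedSum_div_pow e 1 x g

/-- The pairs (exponent, argument) of the strings `1-p, {1}_{mᵢ}, 1/(1-p), {1}_{uᵢ}`, `i ∈ l`,
all exponents being `1`. -/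
noncomputable def argPairs (m u : ℕ → ℕ) (p : ℝ) (l : List ℕ) : List (ℕ × ℝ) :=
  l.flatMap fun i => (1, 1 - p) :: (List.replicate (m i) (1, 1) ++
    (1, 1 / (1 - p)) :: List.replicate (u i) (1, 1))

/-- The pairs (exponent, argument) of the strings `mᵢ+2, {1}_{uᵢ}`, `i ∈ l`, all arguments
being `1`. -/
def expPairs (m u : ℕ → ℕ) (l : List ℕ) : List (ℕ × ℝ) :=
  l.flatMap fun i => (m i + 2, 1) :: List.replicate (u i) (1, 1)

theorem argPairs_cons (m u : ℕ → ℕ) (p : ℝ) (i : ℕ) (l : List ℕ) :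
    argPairs m u p (i :: l) = ((1, 1 - p) :: (List.replicate (m i) (1, 1) ++
      (1, 1 / (1 - p)) :: List.replicate (u i) (1, 1))) ++ argPairs m u p l :=
  List.flatMap_cons

theorem expPairs_cons (m u : ℕ → ℕ) (i : ℕ) (l : List ℕ) :
    expPairs m u (i :: l) = ((m i + 2, 1) :: List.replicate (u i) (1, 1)) ++ expPairs m u l :=
  List.flatMap_cons

theorem nestedSum_expPairs_zero_right (m u : ℕ → ℕ) (l : List ℕ) {g : ℕ → ℝ} (hg : g 0 = 0) :
    nestedSum (expPairs m u l) g 0 = 0 := by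
  cases l with
  | nil => simpa [expPairs]
  | cons i l =>
    rw [expPairs_cons, List.cons_append, nestedSum_cons, weightedSum_zero_right]

/-- Read a block from the inside: `{1}_u` commutes with the transform, `1/(1-p)` changes regime and
divides by `i`, `{1}_m` divides by `iᵐ`, and `1-p` changes back with a genuine summation, giving
exponent `m+2`. -/
theorem nestedSum_argPairs_binomOp (m u : ℕ → ℕ) {p : ℝ} (hp : p ≠ 1) (l : List ℕ)
    {g : ℕ → ℝ} (hg : g 0 = 0) :
    nestedSum (argPairs m u p l) (binomOp p (1 - p) g) =
      binomOp p (1 - p) (nestedSum (expPairs m u l) g) := by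
  induction l with
  | nil => simp [argPairs, expPairs]
  | cons i l ih =>
    have hg' := nestedSum_expPairs_zero_right m u l hg
    have hg'' := nestedSum_replicate_zero_right (u i) hg'
    rw [argPairs_cons, nestedSum_append, ih, expPairs_cons, nestedSum_append, nestedSum_cons, nestedSum_append,
      nestedSum_cons, nestedSum_cons, nestedSum_replicate_binomOp_of_add (by ring) _ hg',
      weightedSum_binomOp_of_inv hp hg'',
      nestedSum_replicate_binomOp_of_one _ _ (by simp [hg'']),
      weightedSum_binomOp_of_mul hp rfl (by simp [hg''])]
    congr 1
    rw [weightedSum_div_pow, weightedSum_div]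
    congr 1
    simp only
    omega

/-- The finite form of the identity: the partial sums of both sides are related by the
binomial operator. -/
theorem nestedSum_argPairs_sub (m u : ℕ → ℕ) {p : ℝ} (hp : p ≠ 1) (l : List ℕ) (k : ℕ)
    (a : ℝ) :
    nestedSum (argPairs m u p l ++ (1, 1 - p) ::
        (List.replicate k (1, 1) ++ [(1, 1 + a * p / (1 - p))])) 1 -
      nestedSum (argPairs m u p l ++ (1, 1 - p) :: (List.replicate k (1, 1) ++ [(1, 1)])) 1 =
    binomOp p (1 - p) (nestedSum (expPairs m u l ++ [(k + 2, a)]) 1) := by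
  -- By the binomial theorem `(1 + ap/(1-p))ⁿ - 1` is the transform of `aⁱ - 0ⁱ`, which vanishes at
  -- `i = 0`. After division by `i` the term `0ⁱ` drops out, as division by zero gives 0.
  have hbase : weightedSum 1 (1 + a * p / (1 - p)) 1 - weightedSum 1 1 1 =
      binomOp (p / (1 - p)) 1 fun i => a ^ i / i := by
    have h1 : weightedSum 1 (1 + a * p / (1 - p)) 1 - weightedSum 1 1 1 =
        weightedSum 1 1 (binomOp (p / (1 - p)) 1 fun i => a ^ i + (-1) * 0 ^ i) := by
      rw [weightedSum_congr 1 (1 + a * p / (1 - p)) 1 (f := 1)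
        (g := fun n => (1 + a * p / (1 - p)) ^ n) (by simp), ← weightedSum_sub]
      congr 1
      ext n
      rw [binomOp_add, binomOp_const_mul, binomOp_pow, binomOp_pow]
      simp only [Pi.sub_apply, Pi.one_apply]
      ring
    rw [h1, weightedSum_binomOp_of_one _ (by simp)]
    congr 1
    ext i
    cases i <;> simp
  rw [nestedSum_append, nestedSum_append, ← nestedSum_sub, nestedSum_cons, nestedSum_cons,
    ← weightedSum_sub, nestedSum_append, nestedSum_append, ← nestedSum_sub, nestedSum_cons,
    nestedSum_cons, nestedSum_nil, hbase, nestedSum_replicate_binomOp_of_one _ _ (by simp),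
    weightedSum_binomOp_of_mul hp rfl (by simp),
    nestedSum_argPairs_binomOp m u hp l (weightedSum_zero_right _ _ _), nestedSum_append]
  congr 2
  rw [weightedSum_div_pow, weightedSum_div, nestedSum_cons, nestedSum_nil]
  ext N
  refine sum_congr rfl fun n _ => ?_
  rw [show 1 + k + 1 = k + 2 by omega]
  simp
  ring

/-! ### Growth estimates for absolute convergence -/

/-- Growth at most of the order of `√n`. -/
def SqrtGrowth (f : ℕ → ℝ) : Prop :=
  ∃ C : ℝ, 0 ≤ C ∧ ∀ n, 1 ≤ n → |f n| ≤ C * √n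

/-- Growth at most of the order of `rⁿ / √n`. -/
def GeomGrowth (r : ℝ) (f : ℕ → ℝ) : Prop :=
  ∃ C : ℝ, 0 ≤ C ∧ ∀ n, 1 ≤ n → |f n| ≤ C * (r ^ n / √n)

/-- Telescoping comparison: `B` serves as a discrete antiderivative dominating `b`. -/
theorem abs_weightedSum_le {e : ℕ} {x : ℝ} {f b B : ℕ → ℝ}
    (hb : ∀ n : ℕ, 1 ≤ n → |x ^ n / (n : ℝ) ^ e * f n| ≤ b n) (hB0 : 0 ≤ B 0)
    (hB : ∀ n, B n + b (n + 1) ≤ B (n + 1)) (N : ℕ) : |weightedSum e x f N| ≤ B N := by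
  induction N with
  | zero => simpa [weightedSum_zero_right]
  | succ N ih =>
    rw [weightedSum_succ]
    exact (abs_add_le _ _).trans ((add_le_add ih (hb (N + 1) (by omega))).trans (hB N))

theorem sqrt_add_inv_sqrt_le (n : ℕ) :
    2 * √(n : ℝ) + 1 / √((n + 1 : ℕ) : ℝ) ≤ 2 * √((n + 1 : ℕ) : ℝ) := by
  have h0 : 0 < √((n + 1 : ℕ) : ℝ) := Real.sqrt_pos.2 (by positivity)
  have h1 := Real.sq_sqrt (show (0 : ℝ) ≤ n by positivity)
  have h2 := Real.sq_sqrt (show (0 : ℝ) ≤ ((n + 1 : ℕ) : ℝ) by positivity)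
  push_cast at *
  rw [← le_sub_iff_add_le', div_le_iff₀ h0]
  nlinarith [sq_nonneg (√((n : ℝ) + 1) - √(n : ℝ))]

/-- Discrete form of `(-3/√x)' ≥ x^(-3/2)`, from `(b - a)(b + a) = 1` for consecutive roots. -/
theorem sub_inv_sqrt_le (n : ℕ) :
    - (3 / √((n + 1 : ℕ) : ℝ)) + 1 / (((n + 2 : ℕ) : ℝ) * √((n + 2 : ℕ) : ℝ)) ≤
      - (3 / √((n + 2 : ℕ) : ℝ)) := by
  have ha : 0 < √((n + 1 : ℕ) : ℝ) := Real.sqrt_pos.2 (by positivity)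
  have hb : 0 < √((n + 2 : ℕ) : ℝ) := Real.sqrt_pos.2 (by positivity)
  have h1 := Real.sq_sqrt (show (0 : ℝ) ≤ ((n + 1 : ℕ) : ℝ) by positivity)
  have h2 := Real.sq_sqrt (show (0 : ℝ) ≤ ((n + 2 : ℕ) : ℝ) by positivity)
  have hab : √((n + 1 : ℕ) : ℝ) ≤ √((n + 2 : ℕ) : ℝ) := Real.sqrt_le_sqrt (by norm_cast; omega)
  set a := √((n + 1 : ℕ) : ℝ)
  set b := √((n + 2 : ℕ) : ℝ)
  have h3 : b ^ 2 = a ^ 2 + 1 := by rw [h1, h2]; push_cast; ring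
  rw [← h2]
  have key : 3 / a - 3 / b - 1 / (b ^ 2 * b) = (3 * b ^ 2 * (b - a) - a) / (a * b ^ 3) := by
    field_simp
  have : 0 ≤ (3 * b ^ 2 * (b - a) - a) / (a * b ^ 3) := by
    refine div_nonneg ?_ (by positivity)
    have h4 : (b - a) * (b + a) = 1 := by linarith
    have h5 : 1 ≤ (b - a) * (2 * b) := by nlinarith
    nlinarith
  linarith

theorem SqrtGrowth.of_bounded {f : ℕ → ℝ} {C : ℝ} (hC : ∀ n, |f n| ≤ C) : SqrtGrowth f := by
  have hC0 : 0 ≤ C := (abs_nonneg _).trans (hC 0)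
  refine ⟨C, hC0, fun n hn => (hC n).trans (le_mul_of_one_le_right hC0 ?_)⟩
  rw [Real.one_le_sqrt]
  exact_mod_cast hn

/-- Sums of `C n^{-3/2}` are bounded. -/
theorem exists_bound_of_term_le {e : ℕ} {x : ℝ} {f : ℕ → ℝ} {C : ℝ} (hC : 0 ≤ C)
    (h : ∀ n : ℕ, 1 ≤ n → |x ^ n / (n : ℝ) ^ e * f n| ≤ C * (1 / (n * √(n : ℝ)))) :
    ∃ C', ∀ N, |weightedSum e x f N| ≤ C' := by
  -- The constant `4 = 3 + 1` makes the majorant equal to the first term at `N = 1`; the case split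
  -- is needed because `3 / √0` evaluates to 0.
  refine ⟨C * 4, fun N => (abs_weightedSum_le (b := fun n => C * (1 / (n * √(n : ℝ))))
    (B := fun n => if n = 0 then 0 else C * (4 - 3 / √(n : ℝ))) h (by simp) ?_ N).trans ?_⟩
  · intro n
    rcases n with _ | n
    · simp
      linarith
    · simp only [Nat.add_eq_zero_iff, one_ne_zero, and_false, if_false]
      have := mul_le_mul_of_nonneg_left (sub_inv_sqrt_le n) hC
      linarith
  · split_ifs
    · positivity
    · refine mul_le_mul_of_nonneg_left ?_ hC
      have : 0 ≤ 3 / √(N : ℝ) := by positivity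
      linarith

theorem SqrtGrowth.exists_bound {e : ℕ} (he : 2 ≤ e) {x : ℝ} (hx : |x| ≤ 1) {f : ℕ → ℝ}
    (hf : SqrtGrowth f) : ∃ C, ∀ N, |weightedSum e x f N| ≤ C := by
  obtain ⟨C, hC, hf⟩ := hf
  refine exists_bound_of_term_le hC fun n hn => ?_
  have hn1 : (1 : ℝ) ≤ n := by exact_mod_cast hn
  have hs := Real.sq_sqrt (show (0 : ℝ) ≤ n by positivity)
  have hs0 : 0 < √(n : ℝ) := Real.sqrt_pos.2 (by linarith)
  rw [abs_mul, abs_div, abs_pow, abs_of_nonneg (by positivity : (0 : ℝ) ≤ (n : ℝ) ^ e)]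
  calc |x| ^ n / (n : ℝ) ^ e * |f n| ≤ 1 / (n : ℝ) ^ 2 * (C * √n) := by
        gcongr
        · exact pow_le_one₀ (abs_nonneg _) hx
        · exact hf n hn
    _ = C * (1 / (n * √(n : ℝ))) := by
        field_simp
        rw [hs, mul_comm]

/-- The class `√n` is stable under any number of these summations, which avoids tracking powers of
logarithms. -/
theorem SqrtGrowth.weightedSum_one {f : ℕ → ℝ} (hf : SqrtGrowth f) :
    SqrtGrowth (weightedSum 1 1 f) := by
  obtain ⟨C, hC, hf⟩ := hf
  refine ⟨C * 2, by positivity, fun N _ => ?_⟩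
  refine abs_weightedSum_le (b := fun n => C * (1 / √(n : ℝ))) (B := fun n => C * 2 * √(n : ℝ))
    (fun n hn => ?_) (by simp) (fun n => ?_) N
  · have hn1 : (1 : ℝ) ≤ n := by exact_mod_cast hn
    have hs := Real.sq_sqrt (show (0 : ℝ) ≤ n by positivity)
    have hs0 : 0 < √(n : ℝ) := Real.sqrt_pos.2 (by linarith)
    rw [one_pow, pow_one, abs_mul, abs_of_nonneg (by positivity : 0 ≤ 1 / (n : ℝ))]
    calc 1 / (n : ℝ) * |f n| ≤ 1 / (n : ℝ) * (C * √n) := by gcongr; exact hf n hn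
      _ = C * (1 / √(n : ℝ)) := by field_simp; rw [hs, mul_comm]
  · have := mul_le_mul_of_nonneg_left (sqrt_add_inv_sqrt_le n) hC
    linarith

/-- For `n ≥ 1` consecutive terms grow by a factor at least `2 / (3/2) = 4/3`, so the sum is
dominated by its last term; the term at 0 is 0 by convention. -/
theorem pow_div_sqrt_add_le {r : ℝ} (hr : 2 ≤ r) (n : ℕ) :
    4 * (r ^ n / √(n : ℝ)) + r ^ (n + 1) / √((n + 1 : ℕ) : ℝ) ≤
      4 * (r ^ (n + 1) / √((n + 1 : ℕ) : ℝ)) := by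
  have h0 : 0 < √((n + 1 : ℕ) : ℝ) := Real.sqrt_pos.2 (by positivity)
  rcases n with _ | n
  · simp
    linarith
  have h1 : 0 < √((n + 1 : ℕ) : ℝ) := Real.sqrt_pos.2 (by positivity)
  have h2 : √((n + 1 + 1 : ℕ) : ℝ) ≤ 3 / 2 * √((n + 1 : ℕ) : ℝ) := by
    rw [Real.sqrt_le_left (by positivity), mul_pow, Real.sq_sqrt (by positivity)]
    push_cast
    have : (0 : ℝ) ≤ n := by positivity
    linarith
  have h3 : 4 * (r ^ (n + 1) / √((n + 1 : ℕ) : ℝ)) ≤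
      3 * (r ^ (n + 1 + 1) / √((n + 1 + 1 : ℕ) : ℝ)) := by
    rw [← mul_div_assoc, ← mul_div_assoc, div_le_div_iff₀ h1 h0, pow_succ r (n + 1)]
    have h4 : 0 < r ^ (n + 1) := by positivity
    have h5 : 4 * √((n + 1 + 1 : ℕ) : ℝ) ≤ 3 * r * √((n + 1 : ℕ) : ℝ) := by nlinarith
    nlinarith [mul_le_mul_of_nonneg_left h5 h4.le]
  linarith

theorem GeomGrowth.of_term_le {r : ℝ} (hr : 2 ≤ r) {x : ℝ} {f : ℕ → ℝ} {C : ℝ} (hC : 0 ≤ C)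
    (h : ∀ n : ℕ, 1 ≤ n → |x ^ n / (n : ℝ) ^ 1 * f n| ≤ C * (r ^ n / √(n : ℝ))) :
    GeomGrowth r (weightedSum 1 x f) := by
  refine ⟨C * 4, by positivity, fun N _ => ?_⟩
  refine abs_weightedSum_le (b := fun n => C * (r ^ n / √(n : ℝ)))
    (B := fun n => C * 4 * (r ^ n / √(n : ℝ))) h (by simp) (fun n => ?_) N
  have := mul_le_mul_of_nonneg_left (pow_div_sqrt_add_le hr n) hC
  linarith

theorem SqrtGrowth.geomGrowth {r : ℝ} (hr : 2 ≤ r) {x : ℝ} (hx : |x| ≤ r) {f : ℕ → ℝ}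
    (hf : SqrtGrowth f) : GeomGrowth r (weightedSum 1 x f) := by
  obtain ⟨C, hC, hf⟩ := hf
  refine GeomGrowth.of_term_le hr hC fun n hn => ?_
  have hn1 : (1 : ℝ) ≤ n := by exact_mod_cast hn
  have hs := Real.sq_sqrt (show (0 : ℝ) ≤ n by positivity)
  have hs0 : 0 < √(n : ℝ) := Real.sqrt_pos.2 (by linarith)
  rw [pow_one, abs_mul, abs_div, abs_pow, abs_of_nonneg (by positivity : (0 : ℝ) ≤ (n : ℝ))]
  calc |x| ^ n / (n : ℝ) * |f n| ≤ r ^ n / (n : ℝ) * (C * √n) := by gcongr; exact hf n hn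
    _ = C * (r ^ n / √(n : ℝ)) := by
        field_simp
        rw [hs, mul_comm]

theorem GeomGrowth.weightedSum_one {r : ℝ} (hr : 2 ≤ r) {f : ℕ → ℝ} (hf : GeomGrowth r f) :
    GeomGrowth r (weightedSum 1 1 f) := by
  obtain ⟨C, hC, hf⟩ := hf
  refine GeomGrowth.of_term_le hr hC fun n hn => ?_
  have hn1 : (1 : ℝ) ≤ n := by exact_mod_cast hn
  rw [one_pow, pow_one, abs_mul, abs_of_nonneg (by positivity : 0 ≤ 1 / (n : ℝ))]
  refine (mul_le_of_le_one_left (abs_nonneg _) ?_).trans (hf n hn)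
  rw [div_le_one (by linarith)]
  exact hn1

/-- The argument cancels the geometric factor and `n^(-3/2)` remains; this is why the class keeps
the factor `1/√n`. -/
theorem GeomGrowth.exists_bound {r : ℝ} (hr : 2 ≤ r) {x : ℝ} (hx : |x| * r ≤ 1) {f : ℕ → ℝ}
    (hf : GeomGrowth r f) : ∃ C, ∀ N, |weightedSum 1 x f N| ≤ C := by
  obtain ⟨C, hC, hf⟩ := hf
  refine exists_bound_of_term_le hC fun n hn => ?_
  have hn1 : (1 : ℝ) ≤ n := by exact_mod_cast hn
  have hs0 : 0 < √(n : ℝ) := Real.sqrt_pos.2 (by linarith)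
  rw [pow_one, abs_mul, abs_div, abs_pow, abs_of_nonneg (by positivity : (0 : ℝ) ≤ (n : ℝ))]
  calc |x| ^ n / (n : ℝ) * |f n| ≤ |x| ^ n / (n : ℝ) * (C * (r ^ n / √n)) := by
        gcongr; exact hf n hn
    _ = (|x| * r) ^ n * (C * (1 / (n * √(n : ℝ)))) := by rw [mul_pow]; field_simp
    _ ≤ C * (1 / (n * √(n : ℝ))) :=
        mul_le_of_le_one_left (by positivity) (pow_le_one₀ (by positivity) hx)

theorem nestedSum_replicate_induction {P : (ℕ → ℝ) → Prop}
    (hP : ∀ f, P f → P (weightedSum 1 1 f)) (k : ℕ) {f : ℕ → ℝ} (hf : P f) :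
    P (nestedSum (List.replicate k (1, 1)) f) := by
  induction k with
  | zero => simpa
  | succ k ih => exact hP _ ih

/-- Replacement of all arguments by their absolute values. -/
def absPairs (L : List (ℕ × ℝ)) : List (ℕ × ℝ) :=
  L.map fun c => (c.1, |c.2|)

theorem absPairs_append (L L' : List (ℕ × ℝ)) : absPairs (L ++ L') = absPairs L ++ absPairs L' :=
  List.map_append

theorem absPairs_cons (c : ℕ × ℝ) (L : List (ℕ × ℝ)) :
    absPairs (c :: L) = (c.1, |c.2|) :: absPairs L := rfl

theorem absPairs_replicate (k : ℕ) : absPairs (List.replicate k (1, 1)) =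
    List.replicate k (1, 1) := by
  simp [absPairs]

/-- Each `{1}_u` may raise a bounded sequence to growth `√n`; the exponent at least 2 in front
restores boundedness. -/
theorem bounded_expPairs (m u : ℕ → ℕ) (l : List ℕ) {f : ℕ → ℝ} (hf : ∃ C, ∀ N, |f N| ≤ C) :
    ∃ C, ∀ N, |nestedSum (absPairs (expPairs m u l)) f N| ≤ C := by
  induction l with
  | nil => simpa [expPairs, absPairs]
  | cons i l ih =>
    obtain ⟨C, hC⟩ := ih
    rw [expPairs_cons, absPairs_append, absPairs_cons,
      absPairs_replicate, nestedSum_append, nestedSum_cons]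
    exact (nestedSum_replicate_induction (P := SqrtGrowth) (fun _ => SqrtGrowth.weightedSum_one) (u i)
      (SqrtGrowth.of_bounded hC)).exists_bound (by omega) (by simp)

/-- A string `q, {1}_k, y` with `|q| ≤ 1/2` and `|q y| ≤ 1` maps growth `√n` to bounded
sequences. -/
theorem bounded_block {q y r : ℝ} (hr : 2 ≤ r) (hq : |q| * r ≤ 1) (hy : |y| ≤ r) (k : ℕ)
    {f : ℕ → ℝ} (hf : SqrtGrowth f) :
    ∃ C, ∀ N, |nestedSum (absPairs ((1, q) :: (List.replicate k (1, 1) ++ [(1, y)]))) f N| ≤ C := by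
  rw [absPairs_cons, absPairs_append, absPairs_replicate, nestedSum_cons, nestedSum_append]
  exact (nestedSum_replicate_induction (P := GeomGrowth r) (fun _ => GeomGrowth.weightedSum_one hr) k
    (hf.geomGrowth hr (x := |y|) (by simpa))).exists_bound hr (by simpa)

theorem bounded_argPairs (m u : ℕ → ℕ) {p r : ℝ} (hr : 2 ≤ r) (hpr : |1 - p| * r = 1)
    (l : List ℕ) {f : ℕ → ℝ} (hf : ∃ C, ∀ N, |f N| ≤ C) :
    ∃ C, ∀ N, |nestedSum (absPairs (argPairs m u p l)) f N| ≤ C := by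
  induction l with
  | nil => simpa [argPairs, absPairs]
  | cons i l ih =>
    obtain ⟨C, hC⟩ := ih
    have h := bounded_block (q := 1 - p) (y := 1 / (1 - p)) hr hpr.le
      (by rw [abs_div, abs_one, div_le_iff₀' (by
        refine (abs_nonneg _).lt_of_ne fun h => ?_
        rw [← h] at hpr
        simp at hpr), hpr]) (m i)
      (nestedSum_replicate_induction (P := SqrtGrowth) (fun _ => SqrtGrowth.weightedSum_one) (u i)
        (SqrtGrowth.of_bounded hC))
    rw [← absPairs_replicate (u i), ← nestedSum_append, ← nestedSum_append, ← absPairs_append,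
      ← absPairs_append] at h
    rw [argPairs_cons]
    simpa only [List.append_assoc, List.cons_append, List.nil_append] using h

/-! ### Translation to polylogarithms and passage to the limit -/

theorem map_snd_argPairs (m u : ℕ → ℕ) (d : ℕ) (p y : ℝ) :
    (argPairs m u p (List.range' 1 (d - 1)) ++ (1, 1 - p) ::
      (List.replicate (m d) (1, 1) ++ [(1, y)])).map Prod.snd =
    argBlocks d m u p ++ [1 - p] ++ List.replicate (m d) 1 ++ [y] := by
  simp [argPairs, argBlocks, List.map_flatMap]

theorem map_fst_argPairs (m u : ℕ → ℕ) (d : ℕ) (p y : ℝ) :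
    (argPairs m u p (List.range' 1 (d - 1)) ++ (1, 1 - p) ::
      (List.replicate (m d) (1, 1) ++ [(1, y)])).map Prod.fst =
    List.replicate (expTuple d m u).sum 1 := by
  refine List.eq_replicate_iff.2 ⟨?_, fun b hb => ?_⟩
  · rw [List.length_map, ← length_args d m u p y, ← map_snd_argPairs, List.length_map]
  · obtain ⟨c, hc, rfl⟩ := List.mem_map.1 hb
    simp only [argPairs, List.mem_append, List.mem_flatMap, List.mem_cons, List.mem_replicate,
      List.not_mem_nil, or_false] at hc
    rcases hc with ⟨i, -, rfl | ⟨-, rfl⟩ | rfl | ⟨-, rfl⟩⟩ | rfl | ⟨-, rfl⟩ | rfl <;> rfl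

theorem map_fst_expPairs (m u : ℕ → ℕ) (d : ℕ) (a : ℝ) :
    (expPairs m u (List.range' 1 (d - 1)) ++ [(m d + 2, a)]).map Prod.fst = expTuple d m u := by
  simp [expPairs, expTuple, List.map_flatMap]

theorem map_snd_expPairs (m u : ℕ → ℕ) (d : ℕ) (a : ℝ) :
    (expPairs m u (List.range' 1 (d - 1)) ++ [(m d + 2, a)]).map Prod.snd =
      onesThen (expTuple d m u).length a := by
  rw [← map_fst_expPairs m u d a, onesThen, List.map_append, List.length_map,
    List.length_append, List.length_singleton, Nat.add_sub_cancel, List.map_singleton]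
  congr 1
  refine List.eq_replicate_iff.2 ⟨List.length_map _, fun b hb => ?_⟩
  obtain ⟨c, hc, rfl⟩ := List.mem_map.1 hb
  simp only [expPairs, List.mem_flatMap, List.mem_cons, List.mem_replicate] at hc
  rcases hc with ⟨i, -, rfl | ⟨-, rfl⟩⟩ <;> rfl

theorem starPolylog_args (d : ℕ) (m u : ℕ → ℕ) {p y : ℝ} (hp : p ∈ Set.Icc (1 / 2 : ℝ) (3 / 2))
    (hp1 : p ≠ 1) (hy : |(1 - p) * y| ≤ 1) :
    StarPolylogConverges (List.replicate (expTuple d m u).sum 1)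
        (argBlocks d m u p ++ [1 - p] ++ List.replicate (m d) 1 ++ [y]) ∧
      Tendsto (nestedSum (argPairs m u p (List.range' 1 (d - 1)) ++ (1, 1 - p) ::
        (List.replicate (m d) (1, 1) ++ [(1, y)])) 1) atTop
        (𝓝 (starPolylog (List.replicate (expTuple d m u).sum 1)
          (argBlocks d m u p ++ [1 - p] ++ List.replicate (m d) 1 ++ [y]))) := by
  have hq0 : 0 < |1 - p| := abs_pos.2 (sub_ne_zero.2 hp1.symm)
  have hq : |1 - p| ≤ 1 / 2 := abs_le.2 ⟨by linarith [hp.2], by linarith [hp.1]⟩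
  -- This is where the range `[1/2, 3/2]` of `p` enters.
  have hr : 2 ≤ |1 - p|⁻¹ := by
    rw [le_inv_comm₀ two_pos hq0]
    linarith
  have hpr : |1 - p| * |1 - p|⁻¹ = 1 := mul_inv_cancel₀ hq0.ne'
  have hyr : |y| ≤ |1 - p|⁻¹ := by
    rwa [← one_div, le_div_iff₀' hq0, ← abs_mul]
  obtain ⟨C, hC⟩ := bounded_argPairs m u hr hpr (List.range' 1 (d - 1))
    (bounded_block hr hpr.le hyr (m d) (f := 1) (SqrtGrowth.of_bounded (C := 1) (by simp)))
  rw [← nestedSum_append, ← absPairs_append] at hC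
  have h := starPolylog_tendsto _ fun N => (le_abs_self _).trans (hC N)
  rwa [map_fst_argPairs, map_snd_argPairs] at h

theorem starPolylog_onesThen (d : ℕ) (m u : ℕ → ℕ) {a : ℝ} (ha : |a| ≤ 1) :
    StarPolylogConverges (expTuple d m u) (onesThen (expTuple d m u).length a) ∧
      Tendsto (nestedSum (expPairs m u (List.range' 1 (d - 1)) ++ [(m d + 2, a)]) 1) atTop
        (𝓝 (starPolylog (expTuple d m u) (onesThen (expTuple d m u).length a))) := by
  obtain ⟨C, hC⟩ := bounded_expPairs m u (List.range' 1 (d - 1))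
    ((SqrtGrowth.of_bounded (f := 1) (C := 1) (by simp)).exists_bound (e := m d + 2) (x := |a|)
      (by omega) (by simpa))
  have h := starPolylog_tendsto (expPairs m u (List.range' 1 (d - 1)) ++ [(m d + 2, a)])
    (C := C) fun N => by
      refine (le_abs_self _).trans ?_
      have := hC N
      rwa [show weightedSum (m d + 2) |a| 1 = nestedSum (absPairs [(m d + 2, a)]) 1 from rfl,
        ← nestedSum_append, ← absPairs_append] at this
  rwa [map_fst_expPairs, map_snd_expPairs] at h

/-- Euler means of order `p`, `0 < p`, preserve the limit whenever both limits exist. -/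
theorem limit_binomOp_eq {p : ℝ} (hp : 0 < p) {g : ℕ → ℝ} {l l' : ℝ}
    (hg : Tendsto g atTop (𝓝 l)) (hg' : Tendsto (binomOp p (1 - p) g) atTop (𝓝 l')) :
    l' = l := by
  rcases le_total p 1 with h | h
  · exact tendsto_nhds_unique hg' (tendsto_binomOp hp h hg)
  -- For `p ≥ 1` regularity is applied to the inverse transform, of order `1/p ≤ 1`.
  · refine tendsto_nhds_unique ?_ hg
    refine (tendsto_binomOp (inv_pos.2 hp) (inv_le_one_of_one_le₀ h) hg').congr fun n => ?_
    exact binomOp_binomOp_of_mul_eq_one (inv_mul_cancel₀ hp.ne') g n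

theorem starPolylog_args_sub (d : ℕ) (m u : ℕ → ℕ) {p : ℝ}
    (hp : p ∈ Set.Icc (1 / 2 : ℝ) (3 / 2)) (hp1 : p ≠ 1) {a : ℝ} (ha : |a| ≤ 1)
    (hy : |(1 - p) * (1 + a * p / (1 - p))| ≤ 1) :
    starPolylog (List.replicate (expTuple d m u).sum 1)
        (argBlocks d m u p ++ [1 - p] ++ List.replicate (m d) 1 ++ [1 + a * p / (1 - p)]) -
      starPolylog (List.replicate (expTuple d m u).sum 1)
        (argBlocks d m u p ++ [1 - p] ++ List.replicate (m d) 1 ++ [1]) =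
      starPolylog (expTuple d m u) (onesThen (expTuple d m u).length a) := by
  have h1 : |(1 - p) * 1| ≤ 1 := abs_le.2 ⟨by linarith [hp.2], by linarith [hp.1]⟩
  have ht := (starPolylog_args d m u hp hp1 hy).2.sub (starPolylog_args d m u hp hp1 h1).2
  refine limit_binomOp_eq (p := p) (by linarith [hp.1]) (starPolylog_onesThen d m u ha).2 ?_
  rw [← nestedSum_argPairs_sub m u hp1]
  exact ht

/-- All indices are at least 1, so a last argument 0 annihilates the innermost sum. -/
theorem starPolylog_args_zero (d : ℕ) (m u : ℕ → ℕ) {p : ℝ}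
    (hp : p ∈ Set.Icc (1 / 2 : ℝ) (3 / 2)) (hp1 : p ≠ 1) :
    starPolylog (List.replicate (expTuple d m u).sum 1)
        (argBlocks d m u p ++ [1 - p] ++ List.replicate (m d) 1 ++ [0]) = 0 := by
  have h := (starPolylog_args d m u hp hp1 (y := 0) (by simp)).2
  have h0 : weightedSum 1 0 1 = 0 := by
    rw [weightedSum_congr 1 0 0 (g := 0) fun n hn => by simp [Nat.one_le_iff_ne_zero.1 hn]]
    exact nestedSum_zero [(1, 0)]
  rw [← List.cons_append, ← List.append_assoc, nestedSum_append, nestedSum_cons, nestedSum_nil,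
    h0, nestedSum_zero] at h
  exact tendsto_nhds_unique h tendsto_const_nhds

theorem mainTheorem4 (d : ℕ) (hd : 1 ≤ d) (m u : ℕ → ℕ) (s : List ℕ)
    (hs : s = expTuple d m u) (p : ℝ) (hp : p ∈ Set.Icc (1 / 2 : ℝ) (3 / 2)) (hp1 : p ≠ 1) :
    (StarPolylogConverges (List.replicate s.sum 1)
        (argBlocks d m u p ++ [1 - p] ++ List.replicate (m d + 1) 1) ∧
      StarPolylogConverges s (onesThen s.length (1 - 1 / p)) ∧
      starPolylog (List.replicate s.sum 1)
          (argBlocks d m u p ++ [1 - p] ++ List.replicate (m d + 1) 1) =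
        -starPolylog s (onesThen s.length (1 - 1 / p))) ∧
    ∀ a : ℝ, a ∈ Set.Icc (-1 : ℝ) (1 / 3) → |a| ≤ min 1 (2 / p - 1) →
      StarPolylogConverges (List.replicate s.sum 1)
        (argBlocks d m u p ++ [1 - p] ++ List.replicate (m d) 1 ++ [1 + a * p / (1 - p)]) ∧
      StarPolylogConverges s (onesThen s.length a) ∧
      starPolylog (List.replicate s.sum 1)
          (argBlocks d m u p ++ [1 - p] ++ List.replicate (m d) 1 ++ [1 + a * p / (1 - p)]) =
        starPolylog s (onesThen s.length a) -
          starPolylog s (onesThen s.length (1 - 1 / p)) := by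
  subst hs
  have hp0 : 0 < p := by linarith [hp.1]
  have hq : 1 - p ≠ 0 := sub_ne_zero.2 hp1.symm
  have h1 : |(1 - p) * 1| ≤ 1 := abs_le.2 ⟨by linarith [hp.2], by linarith [hp.1]⟩
  have hb : |1 - 1 / p| ≤ 1 := by
    have h2 : 1 / p ≤ 2 := by rw [div_le_iff₀ hp0]; linarith [hp.1]
    have h3 : 0 < 1 / p := by positivity
    exact abs_le.2 ⟨by linarith, by linarith⟩
  -- The choice `a = 1 - 1/p` makes the last argument vanish.
  have hb0 : 1 + (1 - 1 / p) * p / (1 - p) = 0 := by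
    field_simp
    ring
  have hone : starPolylog (List.replicate (expTuple d m u).sum 1)
      (argBlocks d m u p ++ [1 - p] ++ List.replicate (m d) 1 ++ [1]) =
        -starPolylog (expTuple d m u) (onesThen (expTuple d m u).length (1 - 1 / p)) := by
    have h := starPolylog_args_sub d m u hp hp1 hb (by rw [hb0]; simp)
    rw [hb0, starPolylog_args_zero d m u hp hp1] at h
    linarith
  constructor
  · rw [List.replicate_succ', ← List.append_assoc]
    exact ⟨(starPolylog_args d m u hp hp1 h1).1, (starPolylog_onesThen d m u hb).1, hone⟩
  · intro a _ ha
    have ha1 := ha.trans (min_le_left _ _)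
    have hy : |(1 - p) * (1 + a * p / (1 - p))| ≤ 1 := by
      have h2 : (1 - p) * (1 + a * p / (1 - p)) = 1 - p * (1 - a) := by
        field_simp
        ring
      -- The condition `|a| ≤ 2/p - 1` is what keeps `1 - p(1 - a)` at least `-1`.
      have h3 : (|a| + 1) * p ≤ 2 := by
        rw [← le_div_iff₀ hp0]
        linarith [ha.trans (min_le_right _ _)]
      rw [h2]
      have h4 := neg_abs_le a
      have h5 := le_abs_self a
      exact abs_le.2 ⟨by nlinarith, by nlinarith⟩
    refine ⟨(starPolylog_args d m u hp hp1 hy).1, (starPolylog_onesThen d m u ha1).1, ?_⟩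
    have h := starPolylog_args_sub d m u hp hp1 ha1 hy
    rw [hone] at h
    linarith
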